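/- Let $\rho$ be a probability density on $[0,1]$, with first moment $c_1=\int_0^1 t\rho(t)\,dt$ and Stieltjes transform $S_\rho(z)=\int_0^1\frac{\rho(t)\,dt}{z-t}$, $z\in\mathbb C\setminus[0,1]$. Assume that $\rho$ has a secondary measure with a density $\mu$, that is, $\mu\ge 0$ is an integrable function on $[0,1]$ with $$S_\mu(z)=z-c_1-\frac1{S_\rho(z)}\qquad (z\in\mathbb C\setminus[0,1]).$$ All functions are real; $L^2(\rho)$ and $L^2(\mu)$ denote the $L^2$ spaces of the measures $\rho(x)\,dx$ and $\mu(x)\,dx$ on $[0,1]$. Let $T_\rho:L^2(\rho)\to L^2(\mu)$ be the continuous linear map that extends the operator $$p\mapsto\Big(x\mapsto\int_0^1\frac{p(t)-p(x)}{t-x}\,\rho(t)\,dt\Big)$$ on polynomials $p$. Let $\varphi(x)=\lim_{\varepsilon\to0^+}2\int_0^1\frac{(x-t)\rho(t)\,dt}{(x-t)^2+\varepsilon^2}$ be the reducer of $\rho$. Assume that $\rho$ is reducible, that is: this limit exists for $\rho$-almost every $x$, it also holds in the norm of $L^2(\rho)$, and $\rho/\mu$ belongs to the image of $T_\rho$.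 Then $T_\rho$ is well defined (there is exactly one such continuous linear extension), and the following composition formula holds. Let $f\in L^2(\rho)$ be such that $\varphi f$ and $T_\rho(f)$ are in $L^2(\rho)$ and $\frac{\rho}{\mu}f$ is in $L^2(\mu)$. Then $$T_\rho\big(\varphi f-T_\rho(f)\big)=\frac{\rho}{\mu}\,f\quad\text{in }L^2(\mu),$$ that is, $T_\rho(\varphi f)=T_\rho^2(f)+\frac{\rho}{\mu}f$. -/

import Mathlib

open MeasureTheory Filter Topology Set Polynomial

noncomputable section

/-- `w` is the density of a finite positive measure on `[0,1]`. -/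
structure IsDensity (w : ℝ → ℝ) : Prop where
  integrable : IntegrableOn w (Icc 0 1)
  nonneg : ∀ᵐ x ∂(volume.restrict (Icc (0 : ℝ) 1)), 0 ≤ w x

/-- `w` is a probability density on `[0,1]`. -/
structure IsProbDensity (w : ℝ → ℝ) : Prop extends IsDensity w where
  mass : ∫ x in Icc (0 : ℝ) 1, w x = 1

/-- The measure `w(x) dx` on `[0,1]`. -/
def densityMeasure (w : ℝ → ℝ) : Measure ℝ :=
  (volume.restrict (Icc 0 1)).withDensity fun x => ENNReal.ofReal (w x)

/-- The Hilbert space `L²([0,1], w)` of real functions. -/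
abbrev L2 (w : ℝ → ℝ) : Type := Lp ℝ 2 (densityMeasure w)

/-- The Stieltjes transform `z ↦ ∫₀¹ w(t) / (z - t) dt`, to be used off `[0,1]`. -/
def stieltjes (w : ℝ → ℝ) (z : ℂ) : ℂ :=
  ∫ t in Icc (0 : ℝ) 1, (w t : ℂ) / (z - (t : ℂ))

/-- The first moment `c₁`. -/
def firstMoment (w : ℝ → ℝ) : ℝ := ∫ t in Icc (0 : ℝ) 1, t * w t

/-- `μ` is the density of the secondary measure of `ρ`. For a probability density `ρ` the
transform of `ρ` does not vanish off `[0,1]`, so the inverse is a genuine one. -/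
structure IsSecondaryDensity (ρ μ : ℝ → ℝ) : Prop extends IsDensity μ where
  stieltjes_eq : ∀ z : ℂ, z ∉ (fun t : ℝ => (t : ℂ)) '' Icc (0 : ℝ) 1 →
    stieltjes μ z = z - (firstMoment ρ : ℂ) - (stieltjes ρ z)⁻¹

/-- The regularised reducer `2 ∫₀¹ (x - t) ρ(t) / ((x - t)² + ε²) dt`. -/
def reducerApprox (ρ : ℝ → ℝ) (ε x : ℝ) : ℝ :=
  2 * ∫ t in Icc (0 : ℝ) 1, (x - t) * ρ t / ((x - t) ^ 2 + ε ^ 2)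

/-- The reducer `φ`, the pointwise limit of the regularised reducers as `ε → 0⁺`. -/
def reducer (ρ : ℝ → ℝ) (x : ℝ) : ℝ :=
  limUnder (𝓝[>] (0 : ℝ)) fun ε => reducerApprox ρ ε x

/-- The secondary polynomial of `p`, `x ↦ ∫₀¹ (p(t) - p(x)) / (t - x) ρ(t) dt`. -/
def secondaryPoly (ρ : ℝ → ℝ) (p : ℝ[X]) (x : ℝ) : ℝ :=
  ∫ t in Icc (0 : ℝ) 1, (p.eval t - p.eval x) / (t - x) * ρ t

/-- The continuous linear map `T : L²(ρ) → L²(μ)` sends (the class of) each polynomial to (the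
class of) its secondary polynomial. -/
def IsSecondaryOperator (ρ μ : ℝ → ℝ) (T : L2 ρ →L[ℝ] L2 μ) : Prop :=
  ∀ (p : ℝ[X]) (F : L2 ρ), F =ᵐ[densityMeasure ρ] (fun x => p.eval x) →
    T F =ᵐ[densityMeasure μ] secondaryPoly ρ p

open Classical in
/-- The operator `T_ρ : L²(ρ) → L²(μ)`: the continuous linear extension of the operator that
creates the secondary polynomials. -/
def secondaryOperator (ρ μ : ℝ → ℝ) : L2 ρ →L[ℝ] L2 μ :=
  if h : ∃ T : L2 ρ →L[ℝ] L2 μ, IsSecondaryOperator ρ μ T then h.choose else 0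

/-- `ρ` (with secondary density `μ`) is reducible: the reducer `φ` exists, it is the limit of the
regularised reducers in `L²(ρ)`, and `ρ/μ` belongs to the image of `T_ρ`. -/
structure IsReducible (ρ μ : ℝ → ℝ) : Prop where
  exists_limit : ∀ᵐ x ∂(densityMeasure ρ),
    ∃ l : ℝ, Tendsto (fun ε => reducerApprox ρ ε x) (𝓝[>] (0 : ℝ)) (𝓝 l)
  memLp_reducer : MemLp (reducer ρ) 2 (densityMeasure ρ)
  tendsto_L2 : Tendsto
    (fun ε => eLpNorm (fun x => reducerApprox ρ ε x - reducer ρ x) 2 (densityMeasure ρ))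
    (𝓝[>] (0 : ℝ)) (𝓝 0)
  quotient_mem_range : ∃ g : L2 ρ,
    secondaryOperator ρ μ g =ᵐ[densityMeasure μ] fun x => ρ x / μ x

end

noncomputable section

/-! ### The measure with a given density -/

/-! Write `T` for the secondary operator and `φ` for the reducer. Two facts carry the formula: `T`
is an isometry up to the constants, and `f ↦ φ f - T f` is a formal adjoint of `T` on `L²(ρ)`.

The isometry reads `⟨T U, T q⟩_μ = ⟨U, q⟩_ρ - ⟨U, 1⟩_ρ ⟨q, 1⟩_ρ` (`inner_secondaryOperator`).
Expanding the Stieltjes relation at infinity relates the moments of `ρ` and `μ`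
(`polyIntegral_X_mul`), and the recursion `T (X p) = X T p + ∫ p ρ` turns this into the isometry on
polynomials. Density of the polynomials then makes `T` well defined, a contraction.

The adjoint identity `∫ (φ f - T f) p ρ = ∫ f (T p) ρ` (`integral_reducer_sub`) is, for a polynomial
`f`, the integrated product rule `∫ T(f p) ρ = ∫ (T f) p ρ + ∫ f (T p) ρ` together with `∫ φ p ρ = ∫
(T p) ρ`, which is the symmetrisation of the odd kernel of `φ`. It passes to all `f` by continuity:
`φ p` is in `L²(ρ)`, and `G ↦ ∫ G p ρ = ∫ G p (ρ/μ) μ` is continuous on `L²(μ)` because `ρ/μ` is in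
`L²(μ)`. Here `ρ` must vanish almost everywhere where `μ` does; this comes from boundary values of
the Stieltjes relation (`ae_eq_zero_of_eq_zero`).

With `U = φ f - T f`, the adjoint identity gives `⟨U, 1⟩_ρ = 0`, since `T 1 = 0`. Hence `⟨T U, T
p⟩_μ = ∫ f (T p) ρ = ⟨(ρ/μ) f, T p⟩_μ`, and the `T p` exhaust the polynomials, which are dense in
`L²(μ)`. -/

theorem densityMeasure_absolutelyContinuous (w : ℝ → ℝ) :
    densityMeasure w ≪ volume.restrict (Icc (0 : ℝ) 1) :=
  withDensity_absolutelyContinuous _ _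

theorem ae_mem_Icc_densityMeasure (w : ℝ → ℝ) : ∀ᵐ x ∂(densityMeasure w), x ∈ Icc (0 : ℝ) 1 :=
  (densityMeasure_absolutelyContinuous w).ae_le (ae_restrict_mem measurableSet_Icc)

namespace IsDensity

variable {w : ℝ → ℝ}

theorem aemeasurable_ofReal (hw : IsDensity w) :
    AEMeasurable (fun x => ENNReal.ofReal (w x)) (volume.restrict (Icc (0 : ℝ) 1)) :=
  hw.integrable.1.aemeasurable.ennreal_ofReal

theorem isFiniteMeasure (hw : IsDensity w) : IsFiniteMeasure (densityMeasure w) :=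
  isFiniteMeasure_withDensity_ofReal hw.integrable.2

theorem integral_eq (hw : IsDensity w) (f : ℝ → ℝ) :
    ∫ x, f x ∂(densityMeasure w) = ∫ x in Icc (0 : ℝ) 1, f x * w x := by
  rw [densityMeasure, integral_withDensity_eq_integral_toReal_smul₀ hw.aemeasurable_ofReal
    (by simp)]
  refine integral_congr_ae ?_
  filter_upwards [hw.nonneg] with x hx
  simp [ENNReal.toReal_ofReal hx, mul_comm]

theorem integral_complex_eq (hw : IsDensity w) (f : ℝ → ℂ) :
    ∫ x, f x ∂(densityMeasure w) = ∫ x in Icc (0 : ℝ) 1, f x * w x := by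
  rw [densityMeasure, integral_withDensity_eq_integral_toReal_smul₀ hw.aemeasurable_ofReal
    (by simp)]
  refine integral_congr_ae ?_
  filter_upwards [hw.nonneg] with x hx
  simp [ENNReal.toReal_ofReal hx, mul_comm]

theorem memLp_of_continuousOn (hw : IsDensity w) {f : ℝ → ℝ} (hf : ContinuousOn f (Icc 0 1))
    (q : ENNReal) : MemLp f q (densityMeasure w) := by
  have := hw.isFiniteMeasure
  obtain ⟨C, hC⟩ := isCompact_Icc.exists_bound_of_continuousOn hf
  refine MemLp.of_bound ?_ C ?_
  · exact (hf.aestronglyMeasurable measurableSet_Icc).mono_ac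
      (densityMeasure_absolutelyContinuous w)
  · filter_upwards [ae_mem_Icc_densityMeasure w] with x hx using hC x hx

theorem integrable_of_continuousOn (hw : IsDensity w) {f : ℝ → ℝ} (hf : ContinuousOn f (Icc 0 1)) :
    Integrable f (densityMeasure w) :=
  memLp_one_iff_integrable.1 (hw.memLp_of_continuousOn hf 1)

theorem integrable_eval (hw : IsDensity w) (p : ℝ[X]) :
    Integrable (fun x => p.eval x) (densityMeasure w) :=
  hw.integrable_of_continuousOn p.continuous.continuousOn

theorem memLp_eval (hw : IsDensity w) (p : ℝ[X]) :
    MemLp (fun x => p.eval x) 2 (densityMeasure w) :=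
  hw.memLp_of_continuousOn p.continuous.continuousOn 2

/-- Integration of polynomials against the density `w`. -/
def polyIntegral (hw : IsDensity w) : ℝ[X] →ₗ[ℝ] ℝ where
  toFun p := ∫ x, p.eval x ∂(densityMeasure w)
  map_add' p q := by
    simp only [eval_add]
    exact integral_add (hw.integrable_eval p) (hw.integrable_eval q)
  map_smul' c p := by
    simp [eval_smul, integral_const_mul]

theorem polyIntegral_apply (hw : IsDensity w) (p : ℝ[X]) :
    hw.polyIntegral p = ∫ x, p.eval x ∂(densityMeasure w) := rfl

/-- Polynomials as elements of `L²(w)`. -/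
def polyToL2 (hw : IsDensity w) : ℝ[X] →ₗ[ℝ] L2 w where
  toFun p := (hw.memLp_eval p).toLp _
  map_add' p q := by
    rw [← MemLp.toLp_add]; congr 1; ext x; simp
  map_smul' c p := by
    rw [RingHom.id_apply, ← MemLp.toLp_const_smul]; congr 1; ext x; simp

theorem coeFn_polyToL2 (hw : IsDensity w) (p : ℝ[X]) :
    hw.polyToL2 p =ᵐ[densityMeasure w] fun x => p.eval x := (hw.memLp_eval p).coeFn_toLp

theorem inner_polyToL2 (hw : IsDensity w) (F : L2 w) (p : ℝ[X]) :
    inner ℝ F (hw.polyToL2 p) = ∫ x, F x * p.eval x ∂(densityMeasure w) := by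
  rw [L2.inner_def]
  refine integral_congr_ae ?_
  filter_upwards [hw.coeFn_polyToL2 p] with x hx
  simp [hx, mul_comm]

theorem inner_polyToL2_polyToL2 (hw : IsDensity w) (p q : ℝ[X]) :
    inner ℝ (hw.polyToL2 p) (hw.polyToL2 q) = hw.polyIntegral (p * q) := by
  rw [inner_polyToL2, polyIntegral_apply]
  refine integral_congr_ae ?_
  filter_upwards [hw.coeFn_polyToL2 p] with x hx
  simp [hx]

/-- Bounded continuous functions are dense in `L²(w)`; Weierstrass approximation on `[0,1]` and
finiteness of the measure do the rest. -/
theorem denseRange_polyToL2 (hw : IsDensity w) : DenseRange hw.polyToL2 := by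
  have := hw.isFiniteMeasure
  rw [Metric.denseRange_iff]
  intro F r hr
  obtain ⟨g, hg, -⟩ := (Lp.memLp F).exists_boundedContinuous_eLpNorm_sub_le (by simp)
    (ε := ENNReal.ofReal (r / 2)) (by simpa using hr)
  set M := (densityMeasure w).real univ ^ ((2 : ENNReal).toReal)⁻¹
  have hM0 : 0 ≤ M := by positivity
  obtain ⟨p, hp⟩ := exists_polynomial_near_of_continuousOn 0 1 g g.continuous.continuousOn
    (r / (2 * (M + 1))) (by positivity)
  refine ⟨p, ?_⟩
  have hgL : MemLp g 2 (densityMeasure w) :=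
    hw.memLp_of_continuousOn g.continuous.continuousOn 2
  have h1 : dist F (hgL.toLp g) ≤ r / 2 := by
    rw [dist_eq_norm, Lp.norm_def]
    refine ENNReal.toReal_le_of_le_ofReal (by positivity) (le_trans (le_of_eq ?_) hg)
    refine eLpNorm_congr_ae ?_
    filter_upwards [Lp.coeFn_sub F (hgL.toLp g), hgL.coeFn_toLp] with x hx hx'
    rw [hx, Pi.sub_apply, Pi.sub_apply, hx']
  have h2 : dist (hgL.toLp g) (hw.polyToL2 p) ≤ M * (r / (2 * (M + 1))) := by
    rw [dist_eq_norm]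
    refine Lp.norm_le_of_ae_bound (by positivity) ?_
    filter_upwards [Lp.coeFn_sub (hgL.toLp g) (hw.polyToL2 p), hgL.coeFn_toLp,
      hw.coeFn_polyToL2 p, ae_mem_Icc_densityMeasure w] with x hx hx' hx'' hxI
    rw [hx, Pi.sub_apply, hx', hx'', Real.norm_eq_abs, abs_sub_comm]
    exact (hp x hxI).le
  have h3 : M * (r / (2 * (M + 1))) < r / 2 := by
    rw [mul_div_assoc', div_lt_div_iff₀ (by positivity) (by positivity)]
    nlinarith
  linarith [dist_triangle F (hgL.toLp g) (hw.polyToL2 p)]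

theorem memLp_mul_eval (hw : IsDensity w) {f : ℝ → ℝ} (hf : MemLp f 2 (densityMeasure w))
    (p : ℝ[X]) : MemLp (fun x => f x * p.eval x) 2 (densityMeasure w) :=
  MemLp.mul (hw.memLp_of_continuousOn p.continuous.continuousOn ⊤) hf

/-! ### Algebra of secondary polynomials -/

/-- The secondary polynomial of `p`, as a function, is the `w`-integral of a polynomial. -/
theorem secondaryPoly_eq (hw : IsDensity w) (p : ℝ[X]) (x : ℝ) :
    secondaryPoly w p x = hw.polyIntegral (p /ₘ (X - C x)) := by
  rw [secondaryPoly, polyIntegral_apply, hw.integral_eq]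
  refine integral_congr_ae ?_
  filter_upwards [ae_restrict_of_ae (Measure.ae_ne volume x)] with t ht
  have h := congrArg (eval t) (X_sub_C_mul_divByMonic_eq_sub_modByMonic p x)
  rw [modByMonic_X_sub_C_eq_C_eval] at h
  simp only [eval_mul, eval_sub, eval_X, eval_C] at h
  have : t - x ≠ 0 := sub_ne_zero.2 ht
  rw [← h]
  field_simp

/-- Uniqueness of division by `X - C x`: linearity and the recursion for `X * p` then only require
exhibiting a quotient. -/
theorem secondaryPoly_eq_of_eq_mul_add (hw : IsDensity w) {p r : ℝ[X]} {x a : ℝ}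
    (h : p = (X - C x) * r + C a) : secondaryPoly w p x = hw.polyIntegral r := by
  rw [hw.secondaryPoly_eq, (div_modByMonic_unique r (C a) (monic_X_sub_C x)
    ⟨by rw [h]; ring, by
      rw [degree_X_sub_C]; exact lt_of_le_of_lt degree_C_le zero_lt_one⟩).1]

theorem eq_X_sub_C_mul_divByMonic_add (p : ℝ[X]) (x : ℝ) :
    p = (X - C x) * (p /ₘ (X - C x)) + C (p.eval x) := by
  rw [X_sub_C_mul_divByMonic_eq_sub_modByMonic, modByMonic_X_sub_C_eq_C_eval, sub_add_cancel]

theorem secondaryPoly_add (hw : IsDensity w) (p q : ℝ[X]) (x : ℝ) :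
    secondaryPoly w (p + q) x = secondaryPoly w p x + secondaryPoly w q x := by
  rw [hw.secondaryPoly_eq p, hw.secondaryPoly_eq q, ← map_add]
  refine hw.secondaryPoly_eq_of_eq_mul_add (a := p.eval x + q.eval x) ?_
  conv_lhs => rw [eq_X_sub_C_mul_divByMonic_add p x, eq_X_sub_C_mul_divByMonic_add q x]
  rw [C_add]; ring

theorem secondaryPoly_smul (hw : IsDensity w) (c : ℝ) (p : ℝ[X]) (x : ℝ) :
    secondaryPoly w (c • p) x = c * secondaryPoly w p x := by
  rw [hw.secondaryPoly_eq p, ← smul_eq_mul, ← map_smul]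
  refine hw.secondaryPoly_eq_of_eq_mul_add (a := c * p.eval x) ?_
  conv_lhs => rw [eq_X_sub_C_mul_divByMonic_add p x]
  rw [smul_eq_C_mul, smul_eq_C_mul, C_mul]; ring

theorem secondaryPoly_C (c x : ℝ) : secondaryPoly w (C c) x = 0 := by
  simp [secondaryPoly]

theorem secondaryPoly_X_mul (hw : IsDensity w) (p : ℝ[X]) (x : ℝ) :
    secondaryPoly w (X * p) x = x * secondaryPoly w p x + hw.polyIntegral p := by
  rw [hw.secondaryPoly_eq p, ← smul_eq_mul x, ← map_smul, ← map_add]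
  refine hw.secondaryPoly_eq_of_eq_mul_add (a := x * p.eval x) ?_
  have h := eq_X_sub_C_mul_divByMonic_add p x
  rw [smul_eq_C_mul, C_mul]
  linear_combination (C x) * h

theorem exists_polynomial_secondaryPoly (hw : IsDensity w) (p : ℝ[X]) :
    ∃ r : ℝ[X], ∀ x, r.eval x = secondaryPoly w p x := by
  induction p using Polynomial.induction_on' with
  | add p q hp hq =>
    obtain ⟨r, hr⟩ := hp
    obtain ⟨s, hs⟩ := hq
    exact ⟨r + s, fun x => by rw [eval_add, hr, hs, hw.secondaryPoly_add]⟩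
  | monomial n a =>
    induction n with
    | zero => exact ⟨0, fun x => by rw [monomial_zero_left, secondaryPoly_C]; simp⟩
    | succ n ih =>
      obtain ⟨r, hr⟩ := ih
      refine ⟨X * r + C (hw.polyIntegral (monomial n a)), fun x => ?_⟩
      rw [← X_mul_monomial, hw.secondaryPoly_X_mul, ← hr]
      simp

/-- The map sending a polynomial to its secondary polynomial. -/
def secPoly (hw : IsDensity w) : ℝ[X] →ₗ[ℝ] ℝ[X] where
  toFun p := (hw.exists_polynomial_secondaryPoly p).choose
  map_add' p q := Polynomial.funext fun x => by
    rw [eval_add, (hw.exists_polynomial_secondaryPoly _).choose_spec,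
      (hw.exists_polynomial_secondaryPoly _).choose_spec,
      (hw.exists_polynomial_secondaryPoly _).choose_spec, hw.secondaryPoly_add]
  map_smul' c p := Polynomial.funext fun x => by
    rw [RingHom.id_apply, eval_smul, (hw.exists_polynomial_secondaryPoly _).choose_spec,
      (hw.exists_polynomial_secondaryPoly _).choose_spec, hw.secondaryPoly_smul, smul_eq_mul]

theorem eval_secPoly (hw : IsDensity w) (p : ℝ[X]) (x : ℝ) :
    (hw.secPoly p).eval x = secondaryPoly w p x :=
  (hw.exists_polynomial_secondaryPoly p).choose_spec x

theorem secPoly_C (hw : IsDensity w) (c : ℝ) : hw.secPoly (C c) = 0 :=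
  Polynomial.funext fun x => by simp [eval_secPoly, secondaryPoly_C]

theorem secPoly_one (hw : IsDensity w) : hw.secPoly 1 = 0 := by
  simpa using hw.secPoly_C 1

theorem secPoly_X_mul (hw : IsDensity w) (p : ℝ[X]) :
    hw.secPoly (X * p) = X * hw.secPoly p + C (hw.polyIntegral p) :=
  Polynomial.funext fun x => by simp [eval_secPoly, hw.secondaryPoly_X_mul]

end IsDensity

/-- A bilinear form on polynomials which is symmetric under moving a factor `X` across and which
vanishes when the first argument is `1` is zero. -/
theorem polynomial_bilin_eq_zero (B : ℝ[X] →ₗ[ℝ] ℝ[X] →ₗ[ℝ] ℝ) (h1 : ∀ q, B 1 q = 0)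
    (hX : ∀ p q, B (X * p) q = B p (X * q)) : B = 0 := by
  ext n m
  suffices h : ∀ n : ℕ, ∀ q, B (X ^ n) q = 0 by
    simpa [monomial_one_right_eq_X_pow] using h n (X ^ m)
  intro n
  induction n with
  | zero => simpa using h1
  | succ n ih => intro q; rw [pow_succ', hX, ih]

/-! ### Surjectivity, product rule and isometry on polynomials -/

namespace IsProbDensity

variable {ρ μ : ℝ → ℝ}

theorem polyIntegral_one (hρ : IsProbDensity ρ) : hρ.polyIntegral 1 = 1 := by
  rw [IsDensity.polyIntegral_apply, hρ.integral_eq]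
  simpa using hρ.mass

theorem isProbabilityMeasure (hρ : IsProbDensity ρ) : IsProbabilityMeasure (densityMeasure ρ) := by
  have := hρ.isFiniteMeasure
  refine ⟨?_⟩
  have h := hρ.polyIntegral_one
  simp only [IsDensity.polyIntegral_apply, eval_one, integral_const, smul_eq_mul, mul_one] at h
  rwa [measureReal_def, ENNReal.toReal_eq_one_iff] at h

theorem secPoly_X (hρ : IsProbDensity ρ) : hρ.secPoly X = 1 := by
  have := hρ.secPoly_X_mul 1
  simpa [hρ.secPoly_one, hρ.polyIntegral_one] using this

/-- The recursion is triangular: it raises a preimage of `X ^ n` to one of `X ^ (n + 1)`, up to a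
constant, and constants are reached because unit mass gives `secPoly X = 1`. -/
theorem secPoly_surjective (hρ : IsProbDensity ρ) : Function.Surjective hρ.secPoly := by
  intro r
  induction r using Polynomial.induction_on' with
  | add p q hp hq =>
    obtain ⟨r, rfl⟩ := hp
    obtain ⟨s, rfl⟩ := hq
    exact ⟨r + s, map_add _ _ _⟩
  | monomial n a =>
    induction n with
    | zero =>
      refine ⟨a • X, ?_⟩
      rw [map_smul, hρ.secPoly_X, monomial_zero_left, smul_eq_C_mul, mul_one]
    | succ n ih =>
      obtain ⟨p, hp⟩ := ih
      refine ⟨X * p - hρ.polyIntegral p • X, ?_⟩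
      rw [map_sub, map_smul, hρ.secPoly_X_mul, hρ.secPoly_X, hp, X_mul_monomial, smul_eq_C_mul]
      ring

/-- The product rule of secondary polynomials, integrated. -/
theorem polyIntegral_secPoly_mul (hρ : IsProbDensity ρ) (p q : ℝ[X]) :
    hρ.polyIntegral (hρ.secPoly (p * q)) =
      hρ.polyIntegral (hρ.secPoly p * q) + hρ.polyIntegral (p * hρ.secPoly q) := by
  let mulL := LinearMap.mul ℝ ℝ[X]
  let B : ℝ[X] →ₗ[ℝ] ℝ[X] →ₗ[ℝ] ℝ :=
    mulL.compr₂ (hρ.polyIntegral ∘ₗ hρ.secPoly) -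
      ((mulL ∘ₗ hρ.secPoly).compr₂ hρ.polyIntegral +
        (mulL.compl₂ hρ.secPoly).compr₂ hρ.polyIntegral)
  have hB : ∀ p q, B p q = hρ.polyIntegral (hρ.secPoly (p * q)) -
      (hρ.polyIntegral (hρ.secPoly p * q) + hρ.polyIntegral (p * hρ.secPoly q)) := fun p q => rfl
  -- Moving `X` across is allowed because the recursion leaves only the symmetric term `∫ p ρ * ∫ q
  -- ρ`.
  have h := polynomial_bilin_eq_zero B (fun q => by simp [hB, hρ.secPoly_one]) (fun p q => by
    have e1 : X * p * q = X * (p * q) := by ring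
    have e2 : p * (X * q) = X * (p * q) := by ring
    have e3 : (X * hρ.secPoly p + C (hρ.polyIntegral p)) * q =
      X * hρ.secPoly p * q + hρ.polyIntegral p • q := by rw [smul_eq_C_mul]; ring
    have e4 : p * (X * hρ.secPoly q + C (hρ.polyIntegral q)) =
      X * p * hρ.secPoly q + hρ.polyIntegral q • p := by rw [smul_eq_C_mul]; ring
    have e5 : hρ.secPoly p * (X * q) = X * hρ.secPoly p * q := by ring
    rw [hB, hB, e1, e2, hρ.secPoly_X_mul p, hρ.secPoly_X_mul q, e3, e4, e5]
    simp only [map_add, map_smul, smul_eq_mul]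
    ring)
  have := hB p q
  rw [h] at this
  simp only [LinearMap.zero_apply] at this
  linarith

/-- The isometry property of the secondary polynomials, given the relation between the moments. -/
theorem polyIntegral_secPoly_mul_secPoly (hρ : IsProbDensity ρ) (hμ : IsDensity μ) {c : ℝ}
    (hm : ∀ p, hρ.polyIntegral (X * p) =
      c * hρ.polyIntegral p + hμ.polyIntegral (hρ.secPoly p)) (p q : ℝ[X]) :
    hμ.polyIntegral (hρ.secPoly p * hρ.secPoly q) =
      hρ.polyIntegral (p * q) - hρ.polyIntegral p * hρ.polyIntegral q := by
  let mulL := LinearMap.mul ℝ ℝ[X]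
  let B : ℝ[X] →ₗ[ℝ] ℝ[X] →ₗ[ℝ] ℝ :=
    ((mulL ∘ₗ hρ.secPoly).compl₂ hρ.secPoly).compr₂ hμ.polyIntegral -
      (mulL.compr₂ hρ.polyIntegral -
        ((LinearMap.mul ℝ ℝ) ∘ₗ hρ.polyIntegral).compl₂ hρ.polyIntegral)
  have hB : ∀ p q, B p q = hμ.polyIntegral (hρ.secPoly p * hρ.secPoly q) -
      (hρ.polyIntegral (p * q) - hρ.polyIntegral p * hρ.polyIntegral q) := fun p q => rfl
  -- The case `p = 1` uses unit mass. After `hm` the remainders of both sides agree, whatever the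
  -- value of `c`.
  have h := polynomial_bilin_eq_zero B
    (fun q => by simp [hB, hρ.secPoly_one, hρ.polyIntegral_one]) (fun p q => by
    have e1 : X * p * q = X * (p * q) := by ring
    have e2 : p * (X * q) = X * (p * q) := by ring
    have e3 : (X * hρ.secPoly p + C (hρ.polyIntegral p)) * hρ.secPoly q =
      X * hρ.secPoly p * hρ.secPoly q + hρ.polyIntegral p • hρ.secPoly q := by
        rw [smul_eq_C_mul]; ring
    have e4 : hρ.secPoly p * (X * hρ.secPoly q + C (hρ.polyIntegral q)) =
      X * hρ.secPoly p * hρ.secPoly q + hρ.polyIntegral q • hρ.secPoly p := by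
        rw [smul_eq_C_mul]; ring
    have hp := hm p
    have hq := hm q
    rw [hB, hB, e1, e2, hρ.secPoly_X_mul p, hρ.secPoly_X_mul q, e3, e4, hp, hq]
    simp only [map_add, map_smul, smul_eq_mul]
    ring)
  have := hB p q
  rw [h] at this
  simp only [LinearMap.zero_apply] at this
  linarith

end IsProbDensity

/-! ### The relation between the moments -/

theorem eq_zero_of_hasSum_pow_eq_zero {e : ℕ → ℝ}
    (h : ∀ u : ℝ, |u| < 1 → HasSum (fun n => u ^ n * e n) 0) (n : ℕ) : e n = 0 := by
  have h1 : HasFPowerSeriesAt (0 : ℝ → ℝ) (FormalMultilinearSeries.ofScalars ℝ e) 0 := by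
    rw [hasFPowerSeriesAt_iff]
    filter_upwards [Metric.ball_mem_nhds (0 : ℝ) one_pos] with u hu
    simpa [FormalMultilinearSeries.coeff_ofScalars] using h u (by simpa using hu)
  have h2 := congrArg (fun p => FormalMultilinearSeries.coeff p n) h1.eq_zero
  rw [FormalMultilinearSeries.coeff_ofScalars] at h2
  rw [h2]
  rfl

namespace IsDensity

variable {w : ℝ → ℝ}

/-- The generating function of the moments. -/
theorem hasSum_moments (hw : IsDensity w) {u : ℝ} (hu : |u| < 1) :
    HasSum (fun n => u ^ n * hw.polyIntegral (X ^ n))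
      (∫ t, (1 - u * t)⁻¹ ∂(densityMeasure w)) := by
  have := hw.isFiniteMeasure
  have hi : ∀ n : ℕ, Integrable (fun t => (u * t) ^ n) (densityMeasure w) := fun n =>
    hw.integrable_of_continuousOn (by fun_prop)
  have h := hasSum_integral_of_summable_integral_norm (F := fun n t => (u * t) ^ n) hi (by
    refine Summable.of_nonneg_of_le (fun n => by positivity) (fun n => ?_)
      ((summable_geometric_of_lt_one (abs_nonneg u) hu).mul_right
        ((densityMeasure w).real univ))
    have h1 : ∫ t, ‖(u * t) ^ n‖ ∂(densityMeasure w) ≤ ∫ _, |u| ^ n ∂(densityMeasure w) := by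
      refine integral_mono_ae (hi n).norm (integrable_const _) ?_
      filter_upwards [ae_mem_Icc_densityMeasure w] with t ht
      rw [norm_pow, Real.norm_eq_abs, abs_mul, abs_of_nonneg ht.1]
      exact pow_le_pow_left₀ (mul_nonneg (abs_nonneg _) ht.1)
        (mul_le_of_le_one_right (abs_nonneg _) ht.2) n
    simpa [mul_comm] using h1)
  have h2 : ∫ t, (1 - u * t)⁻¹ ∂(densityMeasure w) =
      ∫ t, ∑' n : ℕ, (u * t) ^ n ∂(densityMeasure w) := by
    refine integral_congr_ae ?_
    filter_upwards [ae_mem_Icc_densityMeasure w] with t ht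
    rw [tsum_geometric_of_norm_lt_one]
    rw [Real.norm_eq_abs, abs_mul, abs_of_nonneg ht.1]
    exact lt_of_le_of_lt (mul_le_of_le_one_right (abs_nonneg _) ht.2) hu
  rw [h2]
  refine h.congr_fun fun n => ?_
  simp [polyIntegral_apply, mul_pow, integral_const_mul]

/-- The substitution `z = 1/u` turns the expansion at infinity into the moment generating function
at `0`. -/
theorem stieltjes_inv (hw : IsDensity w) {u : ℝ} (hu0 : u ≠ 0) (hu : |u| < 1) :
    stieltjes w ((u : ℂ)⁻¹) = ((u * ∫ t, (1 - u * t)⁻¹ ∂(densityMeasure w) : ℝ) : ℂ) := by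
  rw [stieltjes, ← integral_const_mul, ← integral_complex_ofReal, hw.integral_complex_eq]
  refine setIntegral_congr_fun measurableSet_Icc fun t ht => ?_
  have h1 : (1 : ℝ) - u * t ≠ 0 := by
    have : |u * t| < 1 := by
      rw [abs_mul, abs_of_nonneg ht.1]
      exact lt_of_le_of_lt (mul_le_of_le_one_right (abs_nonneg _) ht.2) hu
    linarith [(abs_lt.1 this).2]
  have h1' : (1 : ℂ) - u * t ≠ 0 := by exact_mod_cast h1
  have h0' : (u : ℂ) ≠ 0 := by exact_mod_cast hu0
  have h2 : (u : ℂ)⁻¹ - t ≠ 0 := by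
    intro h
    apply h1'
    rw [sub_eq_zero] at h
    rw [← h, mul_inv_cancel₀ h0', sub_self]
  push_cast
  field_simp

end IsDensity

/-- The integrand is at least `1/2` on `[0,1]`. Positivity makes the inverse of the Stieltjes
transform of `ρ` a genuine one at `z = 1/u`. -/
theorem IsProbDensity.integral_inv_one_sub_pos {ρ : ℝ → ℝ} (hρ : IsProbDensity ρ) {u : ℝ}
    (hu : |u| < 1) : 0 < ∫ t, (1 - u * t)⁻¹ ∂(densityMeasure ρ) := by
  have := hρ.isProbabilityMeasure
  have hb : ∀ t ∈ Icc (0 : ℝ) 1, 0 < 1 - u * t ∧ 1 - u * t ≤ 2 := by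
    intro t ht
    have : |u * t| < 1 := by
      rw [abs_mul, abs_of_nonneg ht.1]
      exact lt_of_le_of_lt (mul_le_of_le_one_right (abs_nonneg _) ht.2) hu
    exact ⟨by linarith [(abs_lt.1 this).2], by linarith [(abs_lt.1 this).1]⟩
  have h : ∫ _, (2 : ℝ)⁻¹ ∂(densityMeasure ρ) ≤ ∫ t, (1 - u * t)⁻¹ ∂(densityMeasure ρ) := by
    refine integral_mono_ae (integrable_const _) (hρ.integrable_of_continuousOn ?_) ?_
    · exact ContinuousOn.inv₀ (by fun_prop) fun t ht => (hb t ht).1.ne'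
    · filter_upwards [ae_mem_Icc_densityMeasure ρ] with t ht
      exact inv_anti₀ (hb t ht).1 (hb t ht).2
  simp only [integral_const, probReal_univ, smul_eq_mul, one_mul] at h
  linarith

/-- In this convolution form, integration against `μ` yields the coefficients of a Cauchy product of
moment series. -/
theorem IsDensity.secPoly_X_pow_succ {ρ : ℝ → ℝ} (hρ : IsDensity ρ) (n : ℕ) :
    hρ.secPoly (X ^ (n + 1)) =
      ∑ ij ∈ Finset.HasAntidiagonal.antidiagonal n,
        hρ.polyIntegral (X ^ ij.1) • (X ^ ij.2 : ℝ[X]) := by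
  induction n with
  | zero =>
    rw [zero_add, pow_one, ← mul_one X, hρ.secPoly_X_mul]
    simp [hρ.secPoly_one, smul_eq_C_mul]
  | succ n ih =>
    rw [pow_succ', hρ.secPoly_X_mul, ih, Finset.Nat.sum_antidiagonal_succ', Finset.mul_sum]
    simp [smul_eq_C_mul, pow_succ', mul_left_comm, add_comm]

namespace IsSecondaryDensity

variable {ρ μ : ℝ → ℝ}

/-- This is the Stieltjes relation at `z = 1/u`, cleared of denominators so that it also holds at `u
= 0`. -/
theorem generating_eq (hμ : IsSecondaryDensity ρ μ) (hρ : IsProbDensity ρ) {u : ℝ}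
    (hu : |u| < 1) :
    (∫ t, (1 - u * t)⁻¹ ∂(densityMeasure ρ)) - 1
      - firstMoment ρ * u * (∫ t, (1 - u * t)⁻¹ ∂(densityMeasure ρ))
      - u ^ 2 * ((∫ t, (1 - u * t)⁻¹ ∂(densityMeasure ρ)) *
        (∫ t, (1 - u * t)⁻¹ ∂(densityMeasure μ))) = 0 := by
  rcases eq_or_ne u 0 with rfl | hu0
  · have := hρ.isProbabilityMeasure
    simp
  have hpos := hρ.integral_inv_one_sub_pos hu
  have h := hμ.stieltjes_eq ((u : ℂ)⁻¹) (by
    rintro ⟨t, ht, hte⟩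
    have h1 : t = u⁻¹ := by
      have h : (t : ℂ) = (u : ℂ)⁻¹ := hte
      exact_mod_cast h
    have h2 : 1 < |t| := by rw [h1, abs_inv]; exact (one_lt_inv₀ (abs_pos.2 hu0)).2 hu
    rw [abs_of_nonneg ht.1] at h2
    exact absurd ht.2 (not_le.2 h2))
  rw [hμ.toIsDensity.stieltjes_inv hu0 hu, hρ.stieltjes_inv hu0 hu] at h
  have h' : u * (∫ t, (1 - u * t)⁻¹ ∂(densityMeasure μ)) = u⁻¹ - firstMoment ρ -
    (u * ∫ t, (1 - u * t)⁻¹ ∂(densityMeasure ρ))⁻¹ := by exact_mod_cast h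
  set g := ∫ t, (1 - u * t)⁻¹ ∂(densityMeasure ρ)
  have h3 : u ^ 2 * (g * ∫ t, (1 - u * t)⁻¹ ∂(densityMeasure μ)) =
      u * g * (u * ∫ t, (1 - u * t)⁻¹ ∂(densityMeasure μ)) := by ring
  rw [h3, h']
  have := hpos.ne'
  field_simp
  ring

theorem polyIntegral_X_mul (hμ : IsSecondaryDensity ρ μ) (hρ : IsProbDensity ρ) (p : ℝ[X]) :
    hρ.polyIntegral (X * p) = firstMoment ρ * hρ.polyIntegral p +
      hμ.polyIntegral (hρ.secPoly p) := by
  set a : ℕ → ℝ := fun n => hρ.polyIntegral (X ^ n) with ha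
  set d : ℕ → ℝ := fun n => hμ.polyIntegral (hρ.secPoly (X ^ n)) with hd
  have hd0 : d 0 = 0 := by simp [hd, hρ.secPoly_one]
  -- Coefficients of the series in `generating_eq`: the constant term vanishes by unit mass, so the
  -- moment relation for `X ^ n` sits at index `n + 1`.
  set e : ℕ → ℝ := fun n => n.casesOn 0 fun n => a (n + 1) - firstMoment ρ * a n - d n with he
  have key : ∀ n, e n = 0 := by
    refine eq_zero_of_hasSum_pow_eq_zero fun u hu => ?_
    have h1 := hρ.hasSum_moments hu
    have h2 := hμ.hasSum_moments hu
    set g := ∫ t, (1 - u * t)⁻¹ ∂(densityMeasure ρ)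
    set k := ∫ t, (1 - u * t)⁻¹ ∂(densityMeasure μ)
    have h3 : HasSum (fun n => u ^ (n + 1) * d (n + 1)) (u * (g * k)) := by
      have := summable_norm_sum_mul_antidiagonal_of_summable_norm h1.summable.norm h2.summable.norm
      have h4 := this.of_norm.hasSum
      rw [← tsum_mul_tsum_eq_tsum_sum_antidiagonal_of_summable_norm h1.summable.norm
        h2.summable.norm, h1.tsum_eq, h2.tsum_eq] at h4
      refine (h4.mul_left u).congr_fun fun n => ?_
      simp only [hd, hρ.toIsDensity.secPoly_X_pow_succ, map_sum, map_smul, smul_eq_mul,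
        Finset.mul_sum]
      refine Finset.sum_congr rfl fun ij hij => ?_
      rw [← Finset.HasAntidiagonal.mem_antidiagonal.1 hij]
      ring
    have h5 : HasSum (fun n => u ^ n * d n) (u * (g * k)) := by
      rw [hasSum_nat_add_iff (f := fun n => u ^ n * d n) 1] at h3
      simpa [hd0] using h3
    have h6 : HasSum (fun n => u ^ (n + 1) * a (n + 1)) (g - 1) := by
      rw [hasSum_nat_add_iff (f := fun n => u ^ n * a n) 1]
      simpa [ha, hρ.polyIntegral_one] using h1
    have h7 := (h6.sub (h1.mul_left (firstMoment ρ * u))).sub (h5.mul_left u)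
    have h8 : HasSum (fun n => u ^ (n + 1) * e (n + 1)) 0 := by
      have hz : g - 1 - firstMoment ρ * u * g - u * (u * (g * k)) = 0 := by
        rw [← hμ.generating_eq hρ hu]; ring
      rw [hz] at h7
      refine h7.congr_fun fun n => ?_
      simp only [he, ha]
      ring
    rw [hasSum_nat_add_iff (f := fun n => u ^ n * e n) 1] at h8
    simpa [he] using h8
  induction p using Polynomial.induction_on' with
  | add p q hp hq => simp only [mul_add, map_add, hp, hq]; ring
  | monomial n c =>
    have h := key (n + 1)
    simp only [he, ha, hd] at h
    have hc : (monomial n c : ℝ[X]) = c • X ^ n := by rw [smul_X_eq_monomial]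
    rw [hc, mul_smul_comm, ← pow_succ']
    simp only [map_smul, smul_eq_mul]
    linear_combination c * h

end IsSecondaryDensity

/-! ### Boundary values and absolute continuity -/

/-- The (unnormalised) Poisson integral of a measure on the line. -/
def poissonIntegral (ν : Measure ℝ) (ε x : ℝ) : ℝ := ∫ t, ε / ((x - t) ^ 2 + ε ^ 2) ∂ν

/-- The conjugate Poisson integral of a measure on the line. -/
def conjPoissonIntegral (ν : Measure ℝ) (ε x : ℝ) : ℝ := ∫ t, (x - t) / ((x - t) ^ 2 + ε ^ 2) ∂ν

section kernels

variable {ε : ℝ}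

theorem sq_add_sq_pos (hε : 0 < ε) (y : ℝ) : 0 < y ^ 2 + ε ^ 2 := by positivity

theorem continuous_poissonKernel (hε : 0 < ε) (x : ℝ) :
    Continuous fun t : ℝ => ε / ((x - t) ^ 2 + ε ^ 2) :=
  continuous_const.div (by fun_prop) fun t => (sq_add_sq_pos hε _).ne'

theorem continuous_conjPoissonKernel (hε : 0 < ε) :
    Continuous fun y : ℝ => y / (y ^ 2 + ε ^ 2) :=
  continuous_id.div (by fun_prop) fun t => (sq_add_sq_pos hε _).ne'

theorem poissonKernel_le (hε : 0 < ε) (y : ℝ) : ε / (y ^ 2 + ε ^ 2) ≤ 1 / ε := by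
  rw [div_le_div_iff₀ (sq_add_sq_pos hε y) hε]
  nlinarith [sq_nonneg y]

theorem abs_conjPoissonKernel_le (hε : 0 < ε) (y : ℝ) : |y / (y ^ 2 + ε ^ 2)| ≤ 1 / ε := by
  rw [abs_div, abs_of_pos (sq_add_sq_pos hε y), div_le_div_iff₀ (sq_add_sq_pos hε y) hε]
  nlinarith [sq_nonneg (|y| - ε), sq_abs y, abs_nonneg y, sq_nonneg y, sq_nonneg ε]

/-- Both kernels are bounded for fixed `ε > 0`, which suffices for a finite measure. -/
theorem integrable_poissonKernel (ν : Measure ℝ) [IsFiniteMeasure ν] (hε : 0 < ε) (x : ℝ) :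
    Integrable (fun t => ε / ((x - t) ^ 2 + ε ^ 2)) ν :=
  Integrable.of_bound (continuous_poissonKernel hε x).aestronglyMeasurable (1 / ε)
    (.of_forall fun t => by
      rw [Real.norm_eq_abs, abs_of_pos (div_pos hε (sq_add_sq_pos hε _))]
      exact poissonKernel_le hε _)

theorem integrable_conjPoissonKernel (ν : Measure ℝ) [IsFiniteMeasure ν] (hε : 0 < ε) (x : ℝ) :
    Integrable (fun t => (x - t) / ((x - t) ^ 2 + ε ^ 2)) ν :=
  Integrable.of_bound ((continuous_conjPoissonKernel hε).comp
      (continuous_const.sub continuous_id)).aestronglyMeasurable (1 / ε)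
    (.of_forall fun _ => abs_conjPoissonKernel_le hε _)

end kernels

theorem lintegral_rpow_neg_half {a : ℝ} (ha : 0 ≤ a) :
    ∫⁻ s in Ioc 0 a, ENNReal.ofReal (s ^ (-(1 / 2) : ℝ)) = ENNReal.ofReal (2 * √a) := by
  have hi : IntervalIntegrable (fun s : ℝ => s ^ (-(1 / 2) : ℝ)) volume 0 a :=
    intervalIntegral.intervalIntegrable_rpow' (by norm_num)
  rw [← ofReal_integral_eq_lintegral_ofReal
    ((intervalIntegrable_iff_integrableOn_Ioc_of_le ha).1 hi)]
  · rw [← intervalIntegral.integral_of_le ha, integral_rpow (Or.inl (by norm_num)),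
      Real.sqrt_eq_rpow]
    refine congrArg ENNReal.ofReal ?_
    norm_num
    ring
  · filter_upwards [ae_restrict_mem measurableSet_Ioc] with s hs
    exact Real.rpow_nonneg hs.1.le _

/-- If the measure has density at most `C` at every scale around `x`, its Poisson integral at `x`
is at most `4 * C`. -/
theorem lintegral_poissonKernel_le {ν : Measure ℝ} {C x ε : ℝ} (hε : 0 < ε)
    (h : ∀ r, 0 < r → ν (Metric.closedBall x r) ≤ ENNReal.ofReal (2 * C * r)) :
    ∫⁻ t, ENNReal.ofReal (ε / ((x - t) ^ 2 + ε ^ 2)) ∂ν ≤ ENNReal.ofReal (4 * C) := by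
  rcases le_or_gt C 0 with hC | hC
  · have hν : ν = 0 := by
      rw [← Measure.measure_univ_eq_zero, ← Metric.iUnion_closedBall_nat x,
        measure_iUnion_null_iff]
      intro n
      refine measure_mono_null (Metric.closedBall_subset_closedBall
        (show (n : ℝ) ≤ n + 1 by linarith)) ?_
      have := h (n + 1) (by positivity)
      rwa [ENNReal.ofReal_of_nonpos (mul_nonpos_of_nonpos_of_nonneg (by linarith)
        (by positivity)), nonpos_iff_eq_zero] at this
    simp [hν]
  -- Layer cake: the set where the kernel is at least `s` lies in the ball of radius `√(ε/s)` and is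
  -- empty for `s > 1/ε`. Integrating `2 C √(ε/s)` up to `1/ε` gives `4 C`.
  rw [lintegral_eq_lintegral_meas_le ν
    (.of_forall fun t => (div_pos hε (sq_add_sq_pos hε _)).le)
    (continuous_poissonKernel hε x).aemeasurable]
  have hle : ∀ s ∈ Ioi (0 : ℝ), ν {t | s ≤ ε / ((x - t) ^ 2 + ε ^ 2)} ≤
      (Ioc 0 (1 / ε)).indicator
        (fun s => ENNReal.ofReal (2 * C * √ε) * ENNReal.ofReal (s ^ (-(1 / 2) : ℝ))) s := by
    intro s hs
    have hs0 : 0 < s := hs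
    rcases le_or_gt s (1 / ε) with hs1 | hs1
    · rw [indicator_of_mem (show s ∈ Ioc 0 (1 / ε) from ⟨hs0, hs1⟩),
        ← ENNReal.ofReal_mul (by positivity), Real.rpow_neg hs0.le,
        ← Real.sqrt_eq_rpow]
      have h1 := h (√ε * (√s)⁻¹) (by positivity)
      refine (measure_mono ?_).trans (h1.trans (le_of_eq (by ring_nf)))
      intro t ht
      rw [mem_ofPred_eq, le_div_iff₀ (sq_add_sq_pos hε _)] at ht
      rw [Metric.mem_closedBall, Real.dist_eq, ← div_eq_mul_inv, ← Real.sqrt_div' _ hs0.le]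
      apply Real.abs_le_sqrt
      rw [le_div_iff₀ hs0]
      nlinarith [mul_pos hs0 (pow_pos hε 2)]
    · have : {t | s ≤ ε / ((x - t) ^ 2 + ε ^ 2)} = ∅ := by
        rw [eq_empty_iff_forall_notMem]
        intro t ht
        exact absurd (le_trans ht (poissonKernel_le hε _)) (not_le.2 hs1)
      rw [this, measure_empty]
      exact zero_le
  refine (setLIntegral_mono' measurableSet_Ioi hle).trans ?_
  rw [setLIntegral_indicator measurableSet_Ioc, inter_eq_left.2 Ioc_subset_Ioi_self,
    lintegral_const_mul' _ _ ENNReal.ofReal_ne_top, lintegral_rpow_neg_half (by positivity),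
    ← ENNReal.ofReal_mul (by positivity)]
  refine ENNReal.ofReal_le_ofReal (le_of_eq ?_)
  rw [one_div, Real.sqrt_inv]
  have : √ε ≠ 0 := (Real.sqrt_pos.2 hε).ne'
  field_simp
  ring

/-- Restricted to the ball of radius `r₀`, the measure satisfies the density bound at every scale;
outside it the kernel is at most `ε / r₀ ^ 2`. -/
theorem poissonIntegral_le {ν : Measure ℝ} [IsFiniteMeasure ν] {C x ε r₀ : ℝ} (hε : 0 < ε)
    (hC : 0 ≤ C) (hr₀ : 0 < r₀)
    (h : ∀ r ∈ Ioc 0 r₀, ν (Metric.closedBall x r) ≤ ENNReal.ofReal (2 * C * r)) :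
    poissonIntegral ν ε x ≤ 4 * C + ε / r₀ ^ 2 * ν.real univ := by
  have hi := integrable_poissonKernel ν hε x
  have hB : MeasurableSet (Metric.closedBall x r₀) := Metric.isClosed_closedBall.measurableSet
  rw [poissonIntegral, ← integral_add_compl hB hi]
  refine add_le_add ?_ ?_
  · have h1 := lintegral_poissonKernel_le (ν := ν.restrict (Metric.closedBall x r₀)) (C := C)
      (x := x) hε (fun r hr => by
        rw [Measure.restrict_apply Metric.isClosed_closedBall.measurableSet]
        rcases le_or_gt r r₀ with hrr | hrr
        · exact (measure_mono inter_subset_left).trans (h r ⟨hr, hrr⟩)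
        · refine (measure_mono inter_subset_right).trans ((h r₀ ⟨hr₀, le_rfl⟩).trans ?_)
          exact ENNReal.ofReal_le_ofReal (by gcongr))
    rw [integral_eq_lintegral_of_nonneg_ae
      (.of_forall fun t => (div_pos hε (sq_add_sq_pos hε _)).le) hi.1.restrict]
    exact ENNReal.toReal_le_of_le_ofReal (by positivity) h1
  · have h1 : ∫ t in (Metric.closedBall x r₀)ᶜ, ε / ((x - t) ^ 2 + ε ^ 2) ∂ν ≤
        ∫ t in (Metric.closedBall x r₀)ᶜ, ε / r₀ ^ 2 ∂ν := by
      refine setIntegral_mono_on hi.integrableOn (integrable_const _).integrableOn hB.compl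
        fun t ht => ?_
      rw [mem_compl_iff, Metric.mem_closedBall, not_le, Real.dist_eq, abs_sub_comm] at ht
      have : r₀ ^ 2 ≤ (x - t) ^ 2 := by
        rw [← sq_abs (x - t)]
        exact pow_le_pow_left₀ hr₀.le ht.le 2
      exact div_le_div_of_nonneg_left hε.le (by positivity) (by nlinarith [sq_nonneg ε])
    refine h1.trans ?_
    rw [setIntegral_const, smul_eq_mul, mul_comm]
    have := measureReal_mono (μ := ν) (subset_univ (Metric.closedBall x r₀)ᶜ)
    gcongr

/-- The kernel is at least `1 / (2 * ε)` on the ball of radius `ε`. -/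
theorem le_poissonIntegral {ν : Measure ℝ} [IsFiniteMeasure ν] {c x ε : ℝ} (hε : 0 < ε)
    (h : ENNReal.ofReal (2 * c * ε) ≤ ν (Metric.closedBall x ε)) :
    c ≤ poissonIntegral ν ε x := by
  have hi := integrable_poissonKernel ν hε x
  have hB : MeasurableSet (Metric.closedBall x ε) := Metric.isClosed_closedBall.measurableSet
  have h1 : ∫ t in Metric.closedBall x ε, 1 / (2 * ε) ∂ν ≤ poissonIntegral ν ε x := by
    refine (setIntegral_mono_on (integrable_const _).integrableOn hi.integrableOn hB
      fun t ht => ?_).trans (setIntegral_le_integral hi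
        (.of_forall fun t => (div_pos hε (sq_add_sq_pos hε _)).le))
    rw [Metric.mem_closedBall, Real.dist_eq, abs_sub_comm] at ht
    have : (x - t) ^ 2 ≤ ε ^ 2 := sq_le_sq' (abs_le.1 ht).1 (abs_le.1 ht).2
    rw [div_le_div_iff₀ (by positivity) (sq_add_sq_pos hε _)]
    nlinarith
  rw [setIntegral_const, smul_eq_mul] at h1
  have h2 : 2 * c * ε ≤ ν.real (Metric.closedBall x ε) := by
    rw [measureReal_def]
    exact (ENNReal.ofReal_le_iff_le_toReal (measure_ne_top _ _)).1 h
  refine le_trans ?_ h1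
  rw [mul_one_div, le_div_iff₀ (by positivity)]
  linarith

/-! ### Boundary behaviour of densities and of the Stieltjes relation -/

namespace IsDensity

variable {w : ℝ → ℝ}

theorem ae_tendsto_closedBall (hw : IsDensity w) :
    ∀ᵐ x ∂(volume.restrict (Icc (0 : ℝ) 1)),
      Tendsto (fun r => densityMeasure w (Metric.closedBall x r) / ENNReal.ofReal (2 * r))
        (𝓝[>] 0) (𝓝 (ENNReal.ofReal (w x))) := by
  have := hw.isFiniteMeasure
  have h1 := ae_restrict_of_ae (s := Icc (0 : ℝ) 1)
    (Besicovitch.ae_tendsto_rnDeriv (densityMeasure w) (volume : Measure ℝ))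
  have h2 : (densityMeasure w).rnDeriv volume =ᵐ[volume]
      (Icc (0 : ℝ) 1).indicator fun x => ENNReal.ofReal (w x) := by
    rw [densityMeasure, ← withDensity_indicator measurableSet_Icc]
    exact Measure.rnDeriv_withDensity₀ _
      ((aemeasurable_indicator_iff measurableSet_Icc).2 hw.aemeasurable_ofReal)
  filter_upwards [h1, ae_restrict_of_ae h2, ae_restrict_mem measurableSet_Icc] with x hx hx2 hxI
  rw [hx2, indicator_of_mem hxI] at hx
  simpa [Real.volume_closedBall] using hx

theorem eventually_poissonIntegral_le (hw : IsDensity w) {x C : ℝ} (hC : 0 < C)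
    (hx : Tendsto (fun r => densityMeasure w (Metric.closedBall x r) / ENNReal.ofReal (2 * r))
      (𝓝[>] 0) (𝓝 (ENNReal.ofReal (w x)))) (hwC : w x < C) :
    ∀ᶠ ε in 𝓝[>] 0, poissonIntegral (densityMeasure w) ε x ≤ 5 * C := by
  have := hw.isFiniteMeasure
  have h1 := hx.eventually_lt_const ((ENNReal.ofReal_lt_ofReal_iff hC).2 hwC)
  obtain ⟨r₀, hr₀, h2⟩ := (mem_nhdsGT_iff_exists_Ioc_subset).1 h1
  have h3 : Tendsto (fun ε : ℝ => ε / r₀ ^ 2 * (densityMeasure w).real univ) (𝓝[>] 0) (𝓝 0) := by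
    have : Continuous (fun ε : ℝ => ε / r₀ ^ 2 * (densityMeasure w).real univ) := by fun_prop
    simpa using (this.tendsto 0).mono_left nhdsWithin_le_nhds
  filter_upwards [self_mem_nhdsWithin, h3.eventually_lt_const hC] with ε hε hε3
  have h4 := poissonIntegral_le (ν := densityMeasure w) (x := x) hε hC.le hr₀ (fun r hr => by
    have h5 : densityMeasure w (Metric.closedBall x r) / ENNReal.ofReal (2 * r) <
      ENNReal.ofReal C := h2 hr
    have hr0 : 0 < 2 * r := by linarith [hr.1]
    have h6 := (ENNReal.div_le_iff (ENNReal.ofReal_pos.2 hr0).ne' ENNReal.ofReal_ne_top).1 h5.le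
    rw [← ENNReal.ofReal_mul hC.le] at h6
    refine h6.trans (le_of_eq (by ring_nf)))
  linarith

theorem eventually_le_poissonIntegral (hw : IsDensity w) {x c : ℝ} (hc : 0 ≤ c)
    (hx : Tendsto (fun r => densityMeasure w (Metric.closedBall x r) / ENNReal.ofReal (2 * r))
      (𝓝[>] 0) (𝓝 (ENNReal.ofReal (w x)))) (hwc : c < w x) :
    ∀ᶠ ε in 𝓝[>] 0, c ≤ poissonIntegral (densityMeasure w) ε x := by
  have := hw.isFiniteMeasure
  have h1 := hx.eventually_const_lt ((ENNReal.ofReal_lt_ofReal_iff (hc.trans_lt hwc)).2 hwc)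
  filter_upwards [self_mem_nhdsWithin, h1] with ε hε h2
  have hε0 : (0 : ℝ) < ε := hε
  refine le_poissonIntegral hε ?_
  have h3 := (ENNReal.le_div_iff_mul_le (Or.inl (ENNReal.ofReal_pos.2 (by linarith)).ne')
    (Or.inl ENNReal.ofReal_ne_top)).1 h2.le
  rw [← ENNReal.ofReal_mul hc] at h3
  exact le_trans (le_of_eq (by ring_nf)) h3

theorem stieltjes_eq_poisson (hw : IsDensity w) (x : ℝ) {ε : ℝ} (hε : 0 < ε) :
    stieltjes w (x + ε * Complex.I) =
      conjPoissonIntegral (densityMeasure w) ε x -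
        poissonIntegral (densityMeasure w) ε x * Complex.I := by
  have := hw.isFiniteMeasure
  rw [conjPoissonIntegral, poissonIntegral, ← integral_complex_ofReal, ← integral_complex_ofReal,
    ← integral_mul_const, ← integral_sub (integrable_conjPoissonKernel _ hε x).ofReal
      ((integrable_poissonKernel _ hε x).ofReal.mul_const _), hw.integral_complex_eq, stieltjes]
  refine integral_congr_ae (.of_forall fun t => ?_)
  have h1 : ((x - t : ℝ) : ℂ) ^ 2 + (ε : ℂ) ^ 2 ≠ 0 := by
    exact_mod_cast (sq_add_sq_pos hε (x - t)).ne'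
  have h2 : (x + ε * Complex.I - t : ℂ) ≠ 0 := by
    intro h
    have := congrArg Complex.im h
    simp at this
    exact hε.ne' this
  push_cast at h1 ⊢
  rw [div_mul_eq_mul_div, ← sub_div, div_mul_eq_mul_div, div_eq_div_iff h2 h1]
  linear_combination ((w t : ℂ) * (ε : ℂ) ^ 2) * Complex.I_sq

theorem reducerApprox_eq (hw : IsDensity w) (ε x : ℝ) :
    reducerApprox w ε x = 2 * conjPoissonIntegral (densityMeasure w) ε x := by
  rw [reducerApprox, conjPoissonIntegral, hw.integral_eq]
  congr 2
  ext t
  ring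

end IsDensity

/-- Compare imaginary parts of the Stieltjes relation at `x + iε`. -/
theorem IsSecondaryDensity.poissonIntegral_eq {ρ μ : ℝ → ℝ} (hμ : IsSecondaryDensity ρ μ)
    (hρ : IsProbDensity ρ) (x : ℝ) {ε : ℝ} (hε : 0 < ε)
    (hpos : 0 < poissonIntegral (densityMeasure ρ) ε x) :
    poissonIntegral (densityMeasure ρ) ε x =
      (poissonIntegral (densityMeasure μ) ε x + ε) *
        (conjPoissonIntegral (densityMeasure ρ) ε x ^ 2 +
          poissonIntegral (densityMeasure ρ) ε x ^ 2) := by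
  have h := hμ.stieltjes_eq (x + ε * Complex.I) (by
    rintro ⟨t, -, ht⟩
    have := congrArg Complex.im ht
    simp at this
    exact hε.ne this)
  rw [hμ.toIsDensity.stieltjes_eq_poisson x hε, hρ.toIsDensity.stieltjes_eq_poisson x hε] at h
  set P := poissonIntegral (densityMeasure ρ) ε x
  set A := conjPoissonIntegral (densityMeasure ρ) ε x
  have h2 := congrArg Complex.im h
  simp [Complex.inv_im, Complex.normSq_apply] at h2
  have h3 : 0 < A ^ 2 + P ^ 2 := by positivity
  have h4 : poissonIntegral (densityMeasure μ) ε x + ε = P / (A ^ 2 + P ^ 2) := by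
    have : A * A + P * P = A ^ 2 + P ^ 2 := by ring
    rw [this] at h2
    linarith
  rw [h4, div_mul_cancel₀ _ h3.ne']

/-- If its reducer exists, `ρ` vanishes almost everywhere where its secondary density does. -/
theorem IsSecondaryDensity.ae_eq_zero_of_eq_zero {ρ μ : ℝ → ℝ} (hμ : IsSecondaryDensity ρ μ)
    (hρ : IsProbDensity ρ) (hlim : ∀ᵐ x ∂(densityMeasure ρ),
      ∃ l : ℝ, Tendsto (fun ε => reducerApprox ρ ε x) (𝓝[>] (0 : ℝ)) (𝓝 l)) :
    ∀ᵐ x ∂(volume.restrict (Icc (0 : ℝ) 1)), μ x = 0 → ρ x = 0 := by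
  rw [densityMeasure, ae_withDensity_iff' hρ.aemeasurable_ofReal] at hlim
  filter_upwards [hlim, hρ.nonneg, hρ.ae_tendsto_closedBall, hμ.ae_tendsto_closedBall]
    with x hx hx0 hxρ hxμ hμx
  by_contra hne
  have hpos : 0 < ρ x := lt_of_le_of_ne hx0 (Ne.symm hne)
  obtain ⟨l, hl⟩ := hx (ENNReal.ofReal_pos.2 hpos).ne'
  -- If `μ x = 0 < ρ x`, then for small `ε` the factor `A ^ 2 + P ^ 2` is at most `K`, while `Q + ε
  -- ≤ 5 δ + δ`. So `P ≤ 6 δ K < 7 δ K = ρ x / 2 ≤ P`, a contradiction.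
  set K : ℝ := (|l| + 1) ^ 2 + (5 * (ρ x + 1)) ^ 2 with hK
  have hK0 : 0 < K := by positivity
  set δ : ℝ := ρ x / 2 / (7 * K) with hδ
  have hδ0 : 0 < δ := by positivity
  have e1 := hρ.eventually_poissonIntegral_le (C := ρ x + 1) (by linarith) hxρ (by linarith)
  have e2 := hρ.eventually_le_poissonIntegral (c := ρ x / 2) (by linarith) hxρ (by linarith)
  have e3 := hμ.eventually_poissonIntegral_le (C := δ) hδ0 hxμ (by linarith)
  have e4 := hl.abs.eventually_lt_const (show |l| < |l| + 1 by linarith)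
  have e5 : ∀ᶠ ε : ℝ in 𝓝[>] 0, ε < δ := mem_nhdsWithin_of_mem_nhds (Iio_mem_nhds hδ0)
  have e6 : ∀ᶠ ε : ℝ in 𝓝[>] 0, 0 < ε := self_mem_nhdsWithin
  obtain ⟨ε, h1, h2, h3, h4, h5, h6⟩ := (e1.and (e2.and (e3.and (e4.and (e5.and e6))))).exists
  have hP : 0 < poissonIntegral (densityMeasure ρ) ε x := by linarith
  have h7 := hμ.poissonIntegral_eq hρ x h6 hP
  rw [hρ.toIsDensity.reducerApprox_eq] at h4
  set A := conjPoissonIntegral (densityMeasure ρ) ε x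
  set P := poissonIntegral (densityMeasure ρ) ε x
  set Q := poissonIntegral (densityMeasure μ) ε x
  have hA : A ^ 2 ≤ (|l| + 1) ^ 2 := by
    refine sq_le_sq' ?_ ?_ <;> linarith [(abs_lt.1 h4).1, (abs_lt.1 h4).2, abs_nonneg l]
  have hP2 : P ^ 2 ≤ (5 * (ρ x + 1)) ^ 2 := pow_le_pow_left₀ hP.le h1 2
  have h8 : (Q + ε) * (A ^ 2 + P ^ 2) ≤ (6 * δ) * K := by
    refine (mul_le_mul_of_nonneg_right (by linarith) (by positivity)).trans
      (mul_le_mul_of_nonneg_left (by linarith) (by positivity))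
  have h9 : 7 * δ * K = ρ x / 2 := by rw [hδ]; field_simp
  nlinarith [mul_pos hδ0 hK0]

/-! ### The reducer and secondary polynomials -/

theorem Polynomial.exists_lipschitz_Icc (p : ℝ[X]) : ∃ M : ℝ, 0 ≤ M ∧
    ∀ x ∈ Icc (0 : ℝ) 1, ∀ t ∈ Icc (0 : ℝ) 1, |p.eval x - p.eval t| ≤ M * |x - t| := by
  obtain ⟨M, hM⟩ := isCompact_Icc.exists_bound_of_continuousOn
    (p.derivative.continuous.continuousOn (s := Icc (0 : ℝ) 1))
  refine ⟨M, (norm_nonneg _).trans (hM 0 ⟨le_rfl, zero_le_one⟩), fun x hx t ht => ?_⟩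
  exact (convex_Icc (0 : ℝ) 1).norm_image_sub_le_of_norm_hasDerivWithin_le
    (fun y _ => (p.hasDerivAt y).hasDerivWithinAt) hM ht hx

namespace IsDensity

variable {w : ℝ → ℝ}

theorem integrable_conjPoissonKernel_mul_eval (hw : IsDensity w) {ε : ℝ} (hε : 0 < ε)
    (p : ℝ[X]) : Integrable (fun z : ℝ × ℝ => (z.1 - z.2) / ((z.1 - z.2) ^ 2 + ε ^ 2) * p.eval z.1)
      ((densityMeasure w).prod (densityMeasure w)) := by
  have := hw.isFiniteMeasure
  refine ((hw.integrable_eval p).comp_fst _).bdd_mul (c := 1 / ε) ?_ ?_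
  · exact ((continuous_conjPoissonKernel hε).comp
      (continuous_fst.sub continuous_snd)).aestronglyMeasurable
  · exact .of_forall fun z => abs_conjPoissonKernel_le hε _

/-- The kernel is odd, so adding the double integral to its image under the swap uses up the factor
`2` and produces the difference of `p`. -/
theorem integral_reducerApprox_mul_eval (hw : IsDensity w) {ε : ℝ} (hε : 0 < ε) (p : ℝ[X]) :
    ∫ x, reducerApprox w ε x * p.eval x ∂(densityMeasure w) =
      ∫ z : ℝ × ℝ, (z.1 - z.2) / ((z.1 - z.2) ^ 2 + ε ^ 2) * (p.eval z.1 - p.eval z.2)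
        ∂((densityMeasure w).prod (densityMeasure w)) := by
  have := hw.isFiniteMeasure
  have hi := hw.integrable_conjPoissonKernel_mul_eval hε p
  have h1 : ∫ x, reducerApprox w ε x * p.eval x ∂(densityMeasure w) =
      2 * ∫ z : ℝ × ℝ, (z.1 - z.2) / ((z.1 - z.2) ^ 2 + ε ^ 2) * p.eval z.1
        ∂((densityMeasure w).prod (densityMeasure w)) := by
    rw [integral_prod _ hi, ← integral_const_mul]
    congr 1
    ext x
    simp only
    rw [hw.reducerApprox_eq, integral_mul_const, conjPoissonIntegral, mul_assoc]
  have h2 := integral_prod_swap (μ := densityMeasure w) (ν := densityMeasure w)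
    (fun z : ℝ × ℝ => (z.1 - z.2) / ((z.1 - z.2) ^ 2 + ε ^ 2) * p.eval z.1)
  rw [h1, two_mul]
  nth_rewrite 2 [← h2]
  refine (integral_add hi hi.swap).symm.trans ?_
  congr 1
  ext z
  simp only [Function.comp_apply, Prod.fst_swap, Prod.snd_swap]
  rw [← neg_sub z.1 z.2, neg_sq, neg_div]
  ring

theorem polyIntegral_secPoly (hw : IsDensity w) (p : ℝ[X]) :
    hw.polyIntegral (hw.secPoly p) =
      ∫ z : ℝ × ℝ, (p.eval z.2 - p.eval z.1) / (z.2 - z.1)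
        ∂((densityMeasure w).prod (densityMeasure w)) := by
  have := hw.isFiniteMeasure
  obtain ⟨M, hM0, hM⟩ := p.exists_lipschitz_Icc
  have hi : Integrable (fun z : ℝ × ℝ => (p.eval z.2 - p.eval z.1) / (z.2 - z.1))
      ((densityMeasure w).prod (densityMeasure w)) := by
    refine Integrable.of_bound (Measurable.aestronglyMeasurable ?_) M ?_
    · have := p.continuous.measurable
      fun_prop
    · filter_upwards [Measure.quasiMeasurePreserving_fst.ae (ae_mem_Icc_densityMeasure w),
        Measure.quasiMeasurePreserving_snd.ae (ae_mem_Icc_densityMeasure w)] with z h1 h2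
      rw [Real.norm_eq_abs, abs_div]
      exact div_le_of_le_mul₀ (abs_nonneg _) hM0 (hM _ h2 _ h1)
  rw [integral_prod _ hi, polyIntegral_apply]
  congr 1
  ext x
  rw [eval_secPoly, secondaryPoly, hw.integral_eq]

/-- After symmetrisation the integrand is dominated by a Lipschitz constant of `p` on `[0,1]` and
tends to the difference quotient. -/
theorem tendsto_integral_reducerApprox_mul_eval (hw : IsDensity w) (p : ℝ[X]) :
    Tendsto (fun ε => ∫ x, reducerApprox w ε x * p.eval x ∂(densityMeasure w)) (𝓝[>] 0)
      (𝓝 (hw.polyIntegral (hw.secPoly p))) := by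
  have := hw.isFiniteMeasure
  obtain ⟨M, hM0, hM⟩ := p.exists_lipschitz_Icc
  rw [hw.polyIntegral_secPoly]
  refine Tendsto.congr' (f₁ := fun ε => ∫ z : ℝ × ℝ,
    (z.1 - z.2) / ((z.1 - z.2) ^ 2 + ε ^ 2) * (p.eval z.1 - p.eval z.2)
        ∂((densityMeasure w).prod (densityMeasure w))) ?_ ?_
  · filter_upwards [self_mem_nhdsWithin] with ε hε
    rw [hw.integral_reducerApprox_mul_eval hε]
  refine tendsto_integral_filter_of_dominated_convergence (fun _ => M) ?_ ?_
    (integrable_const _) ?_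
  · filter_upwards [self_mem_nhdsWithin] with ε hε
    have h1 := (continuous_conjPoissonKernel hε).comp
      ((continuous_fst (X := ℝ) (Y := ℝ)).sub continuous_snd)
    exact (h1.mul ((p.continuous.comp continuous_fst).sub
      (p.continuous.comp continuous_snd))).aestronglyMeasurable
  · filter_upwards [self_mem_nhdsWithin] with ε hε
    filter_upwards [Measure.quasiMeasurePreserving_fst.ae (ae_mem_Icc_densityMeasure w),
      Measure.quasiMeasurePreserving_snd.ae (ae_mem_Icc_densityMeasure w)] with z h1 h2
    have h3 := hM _ h1 _ h2
    have h4 := sq_add_sq_pos hε (z.1 - z.2)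
    rw [Real.norm_eq_abs, abs_mul, abs_div, abs_of_pos h4, div_mul_eq_mul_div, div_le_iff₀ h4]
    calc |z.1 - z.2| * |p.eval z.1 - p.eval z.2| ≤ |z.1 - z.2| * (M * |z.1 - z.2|) := by gcongr
      _ = M * (z.1 - z.2) ^ 2 := by rw [← sq_abs (z.1 - z.2)]; ring
      _ ≤ M * ((z.1 - z.2) ^ 2 + ε ^ 2) := by gcongr; linarith [sq_nonneg ε]
  · refine .of_forall fun z => ?_
    rcases eq_or_ne z.1 z.2 with h | h
    -- On the diagonal both sides are `0`, since division by zero gives `0`.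
    · simp [h]
    · have hne : z.1 - z.2 ≠ 0 := sub_ne_zero.2 h
      have hc : ContinuousAt (fun ε : ℝ => (z.1 - z.2) / ((z.1 - z.2) ^ 2 + ε ^ 2) *
          (p.eval z.1 - p.eval z.2)) 0 := by
        refine (continuousAt_const.div (by fun_prop) ?_).mul continuousAt_const
        simpa using hne
      have h5 := hc.tendsto.mono_left (nhdsWithin_le_nhds (s := Ioi 0))
      convert h5 using 2
      rw [← neg_sub z.1 z.2, ← neg_sub (p.eval z.1), neg_div_neg_eq]
      field_simp
      simp

end IsDensity

/-- The integrals of the regularised reducers also converge to the left side: `L²` convergence gives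
`L¹` convergence on a finite measure, and `p` is bounded on `[0,1]`. -/
theorem IsReducible.integral_reducer_mul_eval {ρ μ : ℝ → ℝ} (hred : IsReducible ρ μ)
    (hρ : IsProbDensity ρ) (p : ℝ[X]) :
    ∫ x, reducer ρ x * p.eval x ∂(densityMeasure ρ) = hρ.polyIntegral (hρ.secPoly p) := by
  have := hρ.isProbabilityMeasure
  refine tendsto_nhds_unique ?_ (hρ.tendsto_integral_reducerApprox_mul_eval p)
  obtain ⟨C, hC⟩ := isCompact_Icc.exists_bound_of_continuousOn
    (p.continuous.continuousOn (s := Icc (0 : ℝ) 1))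
  have hmem := hρ.memLp_mul_eval hred.memLp_reducer p
  have happ : ∀ ε : ℝ, 0 < ε →
      Integrable (fun x => reducerApprox ρ ε x * p.eval x) (densityMeasure ρ) := by
    intro ε hε
    have h := (hρ.integrable_conjPoissonKernel_mul_eval hε p).integral_prod_left.const_mul 2
    refine h.congr (.of_forall fun x => ?_)
    simp only
    rw [hρ.toIsDensity.reducerApprox_eq, integral_mul_const, conjPoissonIntegral, mul_assoc]
  have happ' : ∀ ε : ℝ, 0 < ε →
      Integrable (fun x => reducerApprox ρ ε x) (densityMeasure ρ) := by
    intro ε hε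
    have h := (hρ.integrable_conjPoissonKernel_mul_eval hε 1).integral_prod_left.const_mul 2
    refine h.congr (.of_forall fun x => ?_)
    simp only [eval_one, mul_one]
    rw [hρ.toIsDensity.reducerApprox_eq, conjPoissonIntegral]
  refine tendsto_integral_of_L1' _ hmem.1 ?_ ?_
  · filter_upwards [self_mem_nhdsWithin] with ε hε using happ ε hε
  · have h0 := ENNReal.Tendsto.const_mul (a := ENNReal.ofReal C) hred.tendsto_L2
      (Or.inr ENNReal.ofReal_ne_top)
    rw [mul_zero] at h0
    refine tendsto_of_tendsto_of_tendsto_of_le_of_le' tendsto_const_nhds h0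
      (.of_forall fun _ => zero_le) ?_
    filter_upwards [self_mem_nhdsWithin] with ε hε
    refine (eLpNorm_le_mul_eLpNorm_of_ae_le_mul (c := C)
      (g := fun x => reducerApprox ρ ε x - reducer ρ x) ?_ 1).trans ?_
    · filter_upwards [ae_mem_Icc_densityMeasure ρ] with x hx
      rw [Pi.sub_apply, ← sub_mul, norm_mul, mul_comm]
      exact mul_le_mul_of_nonneg_right (hC x hx) (norm_nonneg _)
    · gcongr
      exact eLpNorm_le_eLpNorm_of_exponent_le (by norm_num)
        ((happ' ε hε).1.sub hred.memLp_reducer.1)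

/-! ### The secondary operator -/

namespace IsSecondaryDensity

variable {ρ μ : ℝ → ℝ}

theorem inner_secPoly (hμ : IsSecondaryDensity ρ μ) (hρ : IsProbDensity ρ) (p q : ℝ[X]) :
    inner ℝ (hμ.polyToL2 (hρ.secPoly p)) (hμ.polyToL2 (hρ.secPoly q)) =
      inner ℝ (hρ.polyToL2 p) (hρ.polyToL2 q) -
        inner ℝ (hρ.polyToL2 p) (hρ.polyToL2 1) * inner ℝ (hρ.polyToL2 q) (hρ.polyToL2 1) := by
  simp only [IsDensity.inner_polyToL2_polyToL2, mul_one]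
  exact hρ.polyIntegral_secPoly_mul_secPoly hμ.toIsDensity (hμ.polyIntegral_X_mul hρ) p q

theorem norm_secPoly_le (hμ : IsSecondaryDensity ρ μ) (hρ : IsProbDensity ρ) (p : ℝ[X]) :
    ‖hμ.polyToL2 (hρ.secPoly p)‖ ≤ 1 * ‖hρ.polyToL2 p‖ := by
  have h := hμ.inner_secPoly hρ p p
  rw [real_inner_self_eq_norm_sq, real_inner_self_eq_norm_sq] at h
  rw [one_mul]
  refine le_of_sq_le_sq ?_ (norm_nonneg _)
  nlinarith [mul_self_nonneg (inner ℝ (hρ.polyToL2 p) (hρ.polyToL2 1))]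

end IsSecondaryDensity

theorem isSecondaryOperator_iff {ρ μ : ℝ → ℝ} (hρ : IsDensity ρ) (hμ : IsDensity μ)
    (T : L2 ρ →L[ℝ] L2 μ) : IsSecondaryOperator ρ μ T ↔
      ∀ p, T (hρ.polyToL2 p) = hμ.polyToL2 (hρ.secPoly p) := by
  have hs : ∀ p : ℝ[X], (fun x => (hρ.secPoly p).eval x) = secondaryPoly ρ p := fun p =>
    funext fun x => hρ.eval_secPoly p x
  constructor
  · intro h p
    refine Lp.ext ((h p _ (hρ.coeFn_polyToL2 p)).trans ?_)
    rw [← hs]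
    exact (hμ.coeFn_polyToL2 _).symm
  · intro h p F hF
    have hFp : F = hρ.polyToL2 p := Lp.ext (hF.trans (hρ.coeFn_polyToL2 p).symm)
    rw [hFp, h, ← hs]
    exact hμ.coeFn_polyToL2 _

namespace IsSecondaryDensity

variable {ρ μ : ℝ → ℝ}

theorem existsUnique_isSecondaryOperator (hμ : IsSecondaryDensity ρ μ) (hρ : IsProbDensity ρ) :
    ∃! T : L2 ρ →L[ℝ] L2 μ, IsSecondaryOperator ρ μ T := by
  simp only [isSecondaryOperator_iff hρ.toIsDensity hμ.toIsDensity]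
  refine ⟨(hμ.polyToL2 ∘ₗ hρ.secPoly).extendOfNorm hρ.polyToL2, fun p => ?_, fun T hT => ?_⟩
  · exact LinearMap.extendOfNorm_eq hρ.denseRange_polyToL2 ⟨1, hμ.norm_secPoly_le hρ⟩ p
  · exact (LinearMap.extendOfNorm_unique hρ.denseRange_polyToL2 1 (hμ.norm_secPoly_le hρ) T
      (LinearMap.ext hT)).symm

theorem secondaryOperator_polyToL2 (hμ : IsSecondaryDensity ρ μ) (hρ : IsProbDensity ρ)
    (p : ℝ[X]) : secondaryOperator ρ μ (hρ.polyToL2 p) = hμ.polyToL2 (hρ.secPoly p) := by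
  have h := (hμ.existsUnique_isSecondaryOperator hρ).exists
  refine (isSecondaryOperator_iff hρ.toIsDensity hμ.toIsDensity _).1 ?_ p
  rw [secondaryOperator, dif_pos h]
  exact h.choose_spec

/-- `T_ρ` preserves inner products up to the projection to the constants. -/
theorem inner_secondaryOperator (hμ : IsSecondaryDensity ρ μ) (hρ : IsProbDensity ρ) (U : L2 ρ)
    (q : ℝ[X]) :
    inner ℝ (secondaryOperator ρ μ U) (hμ.polyToL2 (hρ.secPoly q)) =
      inner ℝ U (hρ.polyToL2 q) -
        inner ℝ U (hρ.polyToL2 1) * inner ℝ (hρ.polyToL2 q) (hρ.polyToL2 1) := by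
  refine hρ.denseRange_polyToL2.induction_on (p := fun U =>
    inner ℝ (secondaryOperator ρ μ U) (hμ.polyToL2 (hρ.secPoly q)) =
      inner ℝ U (hρ.polyToL2 q) -
        inner ℝ U (hρ.polyToL2 1) * inner ℝ (hρ.polyToL2 q) (hρ.polyToL2 1)) U ?_ ?_
  · exact isClosed_eq (by fun_prop) (by fun_prop)
  · intro p
    rw [hμ.secondaryOperator_polyToL2 hρ, hμ.inner_secPoly hρ]

/-- Where `μ` vanishes, `ρ / μ` is `0` by convention, so mass of `ρ` there would be lost; `h0`
excludes it. -/
theorem integral_mul_div (hμ : IsSecondaryDensity ρ μ) (hρ : IsProbDensity ρ)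
    (h0 : ∀ᵐ x ∂(volume.restrict (Icc (0 : ℝ) 1)), μ x = 0 → ρ x = 0) (u : ℝ → ℝ) :
    ∫ x, u x * (ρ x / μ x) ∂(densityMeasure μ) = ∫ x, u x ∂(densityMeasure ρ) := by
  rw [hμ.integral_eq, hρ.integral_eq]
  refine integral_congr_ae ?_
  filter_upwards [h0] with x hx
  rcases eq_or_ne (μ x) 0 with h | h
  · simp [h, hx h]
  · field_simp

/-- On `L²(ρ)`, the map `f ↦ φ f - T_ρ f` is a formal adjoint of `T_ρ`. -/
theorem integral_reducer_sub (hμ : IsSecondaryDensity ρ μ) (hρ : IsProbDensity ρ)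
    (hred : IsReducible ρ μ) (F : L2 ρ) (p : ℝ[X]) :
    ∫ x, F x * (reducer ρ x * p.eval x) ∂(densityMeasure ρ) -
      ∫ x, secondaryOperator ρ μ F x * p.eval x ∂(densityMeasure ρ) =
        ∫ x, F x * (hρ.secPoly p).eval x ∂(densityMeasure ρ) := by
  have h0 := hμ.ae_eq_zero_of_eq_zero hρ hred.exists_limit
  obtain ⟨g, hg⟩ := hred.quotient_mem_range
  have hφp := hρ.memLp_mul_eval hred.memLp_reducer p
  -- Membership of `ρ / μ` in the image of `T_ρ` serves only to place it in `L²(μ)`.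
  have hqp := hμ.memLp_mul_eval ((Lp.memLp (secondaryOperator ρ μ g)).ae_eq hg) p
  have hA : ∀ F : L2 ρ, ∫ x, F x * (reducer ρ x * p.eval x) ∂(densityMeasure ρ) =
      inner ℝ F (hφp.toLp _) := by
    intro F
    rw [L2.inner_def]
    refine integral_congr_ae ?_
    filter_upwards [hφp.coeFn_toLp] with x hx
    rw [hx, RCLike.inner_apply, conj_trivial]
    ring
  have hB : ∀ G : L2 μ, ∫ x, G x * p.eval x ∂(densityMeasure ρ) =
      inner ℝ G (hqp.toLp _) := by
    intro G
    rw [L2.inner_def, ← hμ.integral_mul_div hρ h0]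
    refine integral_congr_ae ?_
    filter_upwards [hqp.coeFn_toLp] with x hx
    rw [hx, RCLike.inner_apply, conj_trivial]
    ring
  rw [hA, hB, ← hρ.toIsDensity.inner_polyToL2]
  -- Written as inner products, both sides are continuous in `F`, so the product rule on polynomials
  -- suffices.
  refine hρ.denseRange_polyToL2.induction_on (p := fun F =>
    inner ℝ F (hφp.toLp _) - inner ℝ (secondaryOperator ρ μ F) (hqp.toLp _) =
      inner ℝ F (hρ.polyToL2 (hρ.secPoly p))) F ?_ ?_
  · exact isClosed_eq (by fun_prop) (by fun_prop)
  · intro f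
    have h1 : ∫ x, hρ.polyToL2 f x * (reducer ρ x * p.eval x) ∂(densityMeasure ρ) =
        hρ.polyIntegral (hρ.secPoly (f * p)) := by
      rw [← hred.integral_reducer_mul_eval hρ]
      refine integral_congr_ae ?_
      filter_upwards [hρ.coeFn_polyToL2 f] with x hx
      rw [hx, eval_mul]
      ring
    have h2 : inner ℝ (hμ.polyToL2 (hρ.secPoly f)) (hqp.toLp _) =
        hρ.polyIntegral (hρ.secPoly f * p) := by
      rw [IsDensity.polyIntegral_apply, ← hμ.integral_mul_div hρ h0, L2.inner_def]
      refine integral_congr_ae ?_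
      filter_upwards [hqp.coeFn_toLp, hμ.coeFn_polyToL2 (hρ.secPoly f)] with x hx hx'
      rw [hx, hx', eval_mul, RCLike.inner_apply, conj_trivial]
      ring
    rw [← hA, h1, hμ.secondaryOperator_polyToL2 hρ, h2, hρ.toIsDensity.inner_polyToL2_polyToL2,
      hρ.polyIntegral_secPoly_mul]
    ring

end IsSecondaryDensity

end

/-! ### The composition formula -/

theorem mainTheorem3 (ρ μ : ℝ → ℝ) (hρ : IsProbDensity ρ) (hμ : IsSecondaryDensity ρ μ)
    (hred : IsReducible ρ μ) :
    (∃! T : L2 ρ →L[ℝ] L2 μ, IsSecondaryOperator ρ μ T) ∧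
    ∀ (f : ℝ → ℝ) (hf : MemLp f 2 (densityMeasure ρ))
      (hφf : MemLp (fun x => reducer ρ x * f x) 2 (densityMeasure ρ))
      (hTf : MemLp (secondaryOperator ρ μ (hf.toLp f)) 2 (densityMeasure ρ))
      (hqf : MemLp (fun x => ρ x / μ x * f x) 2 (densityMeasure μ)),
      secondaryOperator ρ μ (hφf.toLp _ - hTf.toLp _) = hqf.toLp _ ∧
      secondaryOperator ρ μ (hφf.toLp _) =
        secondaryOperator ρ μ (hTf.toLp _) + hqf.toLp _ := by
  refine ⟨hμ.existsUnique_isSecondaryOperator hρ, fun f hf hφf hTf hqf => ?_⟩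
  have key : secondaryOperator ρ μ (hφf.toLp _ - hTf.toLp _) = hqf.toLp _ := by
    have h0 := hμ.ae_eq_zero_of_eq_zero hρ hred.exists_limit
    have hU : ∀ p : ℝ[X], inner ℝ (hφf.toLp _ - hTf.toLp _) (hρ.polyToL2 p) =
        ∫ x, f x * (hρ.secPoly p).eval x ∂(densityMeasure ρ) := by
      intro p
      have h1 := hμ.integral_reducer_sub hρ hred (hf.toLp f) p
      have h2 : ∫ x, hf.toLp f x * (hρ.secPoly p).eval x ∂(densityMeasure ρ) =
          ∫ x, f x * (hρ.secPoly p).eval x ∂(densityMeasure ρ) := by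
        refine integral_congr_ae ?_
        filter_upwards [hf.coeFn_toLp] with x hx
        rw [hx]
      rw [← h2, ← h1, inner_sub_left, hρ.toIsDensity.inner_polyToL2,
        hρ.toIsDensity.inner_polyToL2]
      congr 1
      · refine integral_congr_ae ?_
        filter_upwards [hf.coeFn_toLp, hφf.coeFn_toLp] with x hx hx'
        rw [hx, hx']
        ring
      · refine integral_congr_ae ?_
        filter_upwards [hTf.coeFn_toLp] with x hx
        rw [hx]
    rw [← sub_eq_zero]
    -- Test against polynomials, each written as a secondary polynomial so that the isometry
    -- applies.
    refine hμ.denseRange_polyToL2.eq_zero_of_inner_left ℝ ?_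
    intro r
    obtain ⟨p, rfl⟩ := hρ.secPoly_surjective r
    have h3 : inner ℝ (hqf.toLp _) (hμ.polyToL2 (hρ.secPoly p)) =
        ∫ x, f x * (hρ.secPoly p).eval x ∂(densityMeasure ρ) := by
      rw [hμ.toIsDensity.inner_polyToL2, ← hμ.integral_mul_div hρ h0]
      refine integral_congr_ae ?_
      filter_upwards [hqf.coeFn_toLp] with x hx
      rw [hx]
      ring
    -- The projection to the constants drops out: `hU 1` and `secPoly 1 = 0` make `φ f - T f`
    -- orthogonal to `1`.
    rw [inner_sub_left, hμ.inner_secondaryOperator hρ, h3, hU p, hU 1, hρ.secPoly_one]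
    simp
  refine ⟨key, ?_⟩
  rw [map_sub] at key
  rw [← key, add_sub_cancel]
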